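/- Let $u=u_0u_1u_2\cdots$ be an aperiodic (i.e. not eventually periodic), uniformly recurrent infinite word over a finite alphabet; uniformly recurrent means that for every factor $w$ of $u$ there is an $L$ such that $w$ occurs in every segment of $u$ of length $L$. For $n\in\mathbb N$ let $R(n)$ be the least $L$ such that every segment of $u$ of length $L$ contains all factors of $u$ of length $n$ (the recurrence function of $u$). For a nonempty factor $w$ of $u$, of length $|w|$, let $$\mathrm{ind}(w)=\sup\{r\in\mathbb Q \mid w^r \text{ is a factor of } u\}\in[1,\infty],$$ where $w^r$ denotes the word $v$ with $|v|\ge |w|$ and $|v|/|w|=r$ that is a prefix of the periodic word $www\cdots$. Then $u$ is Sturmian (i.e. it has exactly $n+1$ distinct factors of length $n$, for every $n\ge 0$) if and only if there exist infinitely many nonempty factors $w$ of $u$ such that $$R(|w|)=|w|\,\mathrm{ind}(w)+1 .$$ -/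

import Mathlib

open scoped ENNReal

namespace InfiniteWord

variable {A : Type*}

/-- The segment `u_i u_{i+1} ⋯ u_{i+n-1}` of the infinite word `u`. -/
def segment (u : ℕ → A) (i n : ℕ) : List A :=
  List.ofFn fun j : Fin n => u (i + j)

/-- The language of `u`: the set of all (finite) factors of `u`. -/
def language (u : ℕ → A) : Set (List A) :=
  {w | ∃ i, segment u i w.length = w}

/-- The set of all factors of `u` of length `n`. -/
def factors (u : ℕ → A) (n : ℕ) : Set (List A) :=
  {w | w ∈ language u ∧ w.length = n}

/-- The factor complexity of `u`: the number of factors of length `n`. -/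
noncomputable def complexity (u : ℕ → A) (n : ℕ) : ℕ :=
  (factors u n).ncard

/-- `u` is Sturmian if it has exactly `n + 1` factors of length `n`, for every `n`. -/
def IsSturmian (u : ℕ → A) : Prop :=
  ∀ n, complexity u n = n + 1

/-- `u` is aperiodic if it is not eventually periodic. -/
def IsAperiodic (u : ℕ → A) : Prop :=
  ¬ ∃ p, 0 < p ∧ ∃ N, ∀ n, N ≤ n → u (n + p) = u n

/-- The word `w` occurs inside the segment of `u` of length `L` that starts at position `k`. -/
def OccursInWindow (u : ℕ → A) (w : List A) (k L : ℕ) : Prop :=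
  ∃ i, k ≤ i ∧ i + w.length ≤ k + L ∧ segment u i w.length = w

/-- `u` is uniformly recurrent if every factor of `u` occurs again and again with bounded gaps,
i.e. in every segment of `u` of some length that depends only on the factor. -/
def IsUniformlyRecurrent (u : ℕ → A) : Prop :=
  ∀ w ∈ language u, ∃ L, ∀ k, OccursInWindow u w k L

/-- The recurrence function of `u`: the least length `L` such that every segment of `u`
of length `L` contains all the factors of `u` of length `n`
(such an `L` exists if `u` is uniformly recurrent over a finite alphabet). -/
noncomputable def recurrenceFunction (u : ℕ → A) (n : ℕ) : ℕ :=
  sInf {L | ∀ k, ∀ w ∈ factors u n, OccursInWindow u w k L}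

/-- `v` is a power of the nonempty word `w`: `|w| ≤ |v|`, and `v` is a prefix of the periodic
word `www⋯`. One writes `v = w ^ r` with the rational exponent `r = |v| / |w|`. -/
def IsPower (v w : List A) : Prop :=
  w ≠ [] ∧ w.length ≤ v.length ∧ ∀ i, i < v.length → v[i]? = w[i % w.length]?

/-- The index of `w` in `u`: the supremum, in `[0, ∞]`, of the exponents `r = |v| / |w|`
of those powers `v = w ^ r` of `w` that are factors of `u`. -/
noncomputable def ind (u : ℕ → A) (w : List A) : ℝ≥0∞ :=
  sSup {r | ∃ v ∈ language u, IsPower v w ∧ r = (v.length : ℝ≥0∞) / (w.length : ℝ≥0∞)}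

end InfiniteWord

namespace InfiniteWord

variable {A : Type*}

/-! Suppose R(n) = n ind(w) + 1 with n = |w|. Then the index is attained by a power v of length R(n)
- 1, so v and the letter after it contain all factors of length n. By periodicity v shows at most n
of them, and the extra letter adds at most one. So the complexity is at most n + 1 for arbitrarily
large n; since it grows strictly in an aperiodic word, it is n + 1 everywhere.

Conversely, let u be Sturmian and let n be the shortest return time of its factors of length K,
attained at s; then n ≤ K, and n tends to infinity with K. The stretch of period n at s shows n
distinct conjugates, so exactly one factor x of length n lies off this cycle. The cycle is left only
at the unique right special factor, so the windows around x are determined as long as they stay on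
the cycle. By an argument of Fine–Wilf type, x does not return within n steps
(`add_lt_of_not_onCycle`). If a longest run of windows on the cycle has N members, it spans a
longest power, of length N + n - 1 = n ind(w). This power misses x, while any N + 1 consecutive
windows show all factors (`exists_agree_of_longest_run`), so R(n) = N + n. -/

/-- The windows of length `n` of `u` at the positions `i` and `j` agree. -/
def Agree (u : ℕ → A) (n i j : ℕ) : Prop :=
  ∀ k, k < n → u (i + k) = u (j + k)

/-- The window of length `n` at position `i` is right special. -/
def IsRightSpecial (u : ℕ → A) (n i : ℕ) : Prop :=
  ∃ j, Agree u n i j ∧ u (i + n) ≠ u (j + n)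

variable {u : ℕ → A} {n i j K s : ℕ}

/-! ### Agreement of windows; segments and factors -/

lemma Agree.symm (h : Agree u n i j) : Agree u n j i := fun k hk => (h k hk).symm

lemma Agree.trans {k : ℕ} (h : Agree u n i j) (h' : Agree u n j k) : Agree u n i k :=
  fun t ht => (h t ht).trans (h' t ht)

lemma Agree.mono {m : ℕ} (h : Agree u n i j) (hm : m ≤ n) : Agree u m i j :=
  fun t ht => h t (ht.trans_le hm)

lemma Agree.succ (h : Agree u n i j) (h' : u (i + n) = u (j + n)) : Agree u (n + 1) i j := by
  intro k hk
  rcases Nat.lt_succ_iff_lt_or_eq.mp hk with hk | rfl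
  · exact h k hk
  · exact h'

lemma Agree.shift (h : Agree u n i j) (h' : u (i + n) = u (j + n)) :
    Agree u n (i + 1) (j + 1) := by
  intro k hk
  have := h.succ h' (k + 1) (by omega)
  rwa [show i + 1 + k = i + (k + 1) by omega, show j + 1 + k = j + (k + 1) by omega]

@[simp]
lemma length_segment (u : ℕ → A) (i n : ℕ) : (segment u i n).length = n := by
  simp [segment]

lemma segment_eq_iff : segment u i n = segment u j n ↔ Agree u n i j := by
  unfold segment Agree
  rw [List.ofFn_inj, funext_iff]
  exact ⟨fun h k hk => h ⟨k, hk⟩, fun h k => h k k.2⟩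

lemma getElem?_segment {k : ℕ} (hk : k < n) : (segment u i n)[k]? = some (u (i + k)) := by
  simp [segment, hk]

lemma segment_mem_language (u : ℕ → A) (i n : ℕ) : segment u i n ∈ language u :=
  ⟨i, by simp⟩

lemma factors_eq_range (u : ℕ → A) (n : ℕ) :
    factors u n = Set.range fun i => segment u i n := by
  ext w
  constructor
  · rintro ⟨⟨i, hi⟩, rfl⟩
    exact ⟨i, hi⟩
  · rintro ⟨i, rfl⟩
    exact ⟨segment_mem_language u i n, length_segment u i n⟩

lemma segment_mem_factors (u : ℕ → A) (i n : ℕ) : segment u i n ∈ factors u n := by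
  rw [factors_eq_range]; exact ⟨i, rfl⟩

lemma finite_factors [Finite A] (u : ℕ → A) (n : ℕ) : (factors u n).Finite :=
  (List.finite_length_eq A n).subset fun _ hw => hw.2

lemma dropLast_segment (u : ℕ → A) (i n : ℕ) :
    (segment u i (n + 1)).dropLast = segment u i n := by
  unfold segment
  rw [List.ofFn_succ', List.concat_eq_append, List.dropLast_concat]
  rfl

lemma occursInWindow_segment {k L : ℕ} :
    OccursInWindow u (segment u i n) k L ↔
      ∃ j, k ≤ j ∧ j + n ≤ k + L ∧ Agree u n j i := by
  simp only [OccursInWindow, length_segment, segment_eq_iff]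

/-! ### Right special factors and complexity -/

lemma IsAperiodic.exists_ne (haper : IsAperiodic u) {e : ℕ} (he : 0 < e) (i m : ℕ)
    (h : Agree u m (i + e) i) :
    ∃ k, m ≤ k ∧ Agree u k (i + e) i ∧ u (i + e + k) ≠ u (i + k) := by
  classical
  have hex : ∃ k, u (i + e + k) ≠ u (i + k) := by
    by_contra! hcon
    refine haper ⟨e, he, i, fun n hn => ?_⟩
    have := hcon (n - i)
    rwa [show i + e + (n - i) = n + e by omega, show i + (n - i) = n by omega] at this
  refine ⟨Nat.find hex, ?_, fun k hk => not_not.mp (Nat.find_min hex hk), Nat.find_spec hex⟩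
  by_contra! hlt
  exact Nat.find_spec hex (h _ hlt)

/-- A stretch of `u` with period `e` and of length at least `m + e` ends, in an aperiodic word,
in a right special factor of length `m` which has period `e` and is part of the stretch. -/
lemma IsAperiodic.exists_isRightSpecial (haper : IsAperiodic u) {e : ℕ} (he : 0 < e) {i m : ℕ}
    (h : Agree u m (i + e) i) :
    ∃ a, Agree u (a + m) (i + e) i ∧ IsRightSpecial u m (i + a) := by
  obtain ⟨k, hk, hag, hne⟩ := haper.exists_ne he i m h
  refine ⟨k - m, by rwa [Nat.sub_add_cancel hk], i + e + (k - m), fun t ht => ?_, ?_⟩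
  · have := hag (k - m + t) (by omega)
    rw [← add_assoc, ← add_assoc] at this
    exact this.symm
  · rw [show i + (k - m) + m = i + k by omega, show i + e + (k - m) + m = i + e + k by omega]
    exact hne.symm

/-- By pigeonhole some window repeats, and the end of the resulting periodic stretch gives a right
special factor. Deleting one of its extensions still leaves an extension of every factor of length
`n`. -/
lemma IsAperiodic.complexity_lt_succ [Finite A] (haper : IsAperiodic u) (n : ℕ) :
    complexity u n < complexity u (n + 1) := by
  obtain ⟨i, j, hij, hag⟩ : ∃ i j, i < j ∧ Agree u n i j := by
    have : ¬ Function.Injective fun i : ℕ => (⟨_, segment_mem_factors u i n⟩ : factors u n) := by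
      have := (finite_factors u n).to_subtype
      exact not_injective_infinite_finite _
    simp only [Function.Injective, Subtype.mk.injEq, segment_eq_iff] at this
    push Not at this
    obtain ⟨i, j, h, hne⟩ := this
    rcases lt_or_gt_of_ne hne with hlt | hlt
    · exact ⟨i, j, hlt, h⟩
    · exact ⟨j, i, hlt, h.symm⟩
  obtain ⟨a, -, j', hj', hne⟩ := haper.exists_isRightSpecial (e := j - i) (i := i) (m := n)
    (by omega) (by rw [show i + (j - i) = j by omega]; exact hag.symm)
  have hsub : factors u n ⊆ List.dropLast '' (factors u (n + 1) \ {segment u j' (n + 1)}) := by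
    rw [factors_eq_range]
    rintro _ ⟨m, rfl⟩
    by_cases hm : Agree u (n + 1) m j'
    · refine ⟨segment u (i + a) (n + 1), ⟨segment_mem_factors .., ?_⟩, ?_⟩
      · rw [Set.mem_singleton_iff, segment_eq_iff]
        exact fun h => hne (h n (by omega))
      · rw [dropLast_segment]
        exact segment_eq_iff.2 fun k hk => (hj' k hk).trans (hm k (by omega)).symm
    · exact ⟨_, ⟨segment_mem_factors u m _, by rwa [Set.mem_singleton_iff, segment_eq_iff]⟩,
        dropLast_segment ..⟩
  have hfin := finite_factors u (n + 1)
  calc complexity u n ≤ _ := Set.ncard_le_ncard hsub (hfin.sdiff.image _)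
    _ ≤ (factors u (n + 1) \ {segment u j' (n + 1)}).ncard := Set.ncard_image_le hfin.sdiff
    _ < complexity u (n + 1) := Set.ncard_sdiff_singleton_lt_of_mem (segment_mem_factors ..) hfin

lemma complexity_zero (u : ℕ → A) : complexity u 0 = 1 := by
  rw [complexity, Set.ncard_eq_one]
  refine ⟨[], ?_⟩
  rw [factors_eq_range]
  ext w
  simp [segment]

/-- Strict growth from the value 1 at length 0 gives the lower bound, and any excess over `n + 1`
would persist at all larger lengths. -/
lemma IsAperiodic.isSturmian_of_frequently [Finite A] (haper : IsAperiodic u)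
    (h : ∀ N, ∃ n, N ≤ n ∧ complexity u n ≤ n + 1) : IsSturmian u := by
  have hmono : ∀ n k, complexity u n + k ≤ complexity u (n + k) := by
    intro n k
    induction k with
    | zero => simp
    | succ k ih => have := haper.complexity_lt_succ (n + k); rw [← add_assoc n]; omega
  intro n
  obtain ⟨m, hm, hle⟩ := h n
  have h1 := hmono 0 n
  have h2 := hmono n (m - n)
  rw [complexity_zero, zero_add] at h1
  rw [show n + (m - n) = m by omega] at h2
  omega

lemma IsSturmian.finite_factors (h : IsSturmian u) (n : ℕ) : (factors u n).Finite :=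
  Set.finite_of_ncard_pos (by have := h n; unfold complexity at this; omega)

/-- A Sturmian word has only one right special factor of each length. -/
lemma IsSturmian.agree_of_isRightSpecial (h : IsSturmian u) (hi : IsRightSpecial u n i)
    (hj : IsRightSpecial u n j) : Agree u n i j := by
  by_contra hij
  obtain ⟨i', hii, hi⟩ := hi
  obtain ⟨j', hjj, hj⟩ := hj
  have hne : ∀ {a b a'}, Agree u n a a' → Agree u n b j' → Agree u n i a' → Agree u (n + 1) a b →
      False := fun h1 h2 h3 h4 =>
    hij ((h3.trans h1.symm).trans (((h4.mono n.le_succ).trans h2).trans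
      hjj.symm))
  -- With two right special factors, one extension of each can be spared, so the complexity would
  -- grow by at least 2.
  have hsub : factors u n ⊆ List.dropLast ''
      (factors u (n + 1) \ {segment u i' (n + 1), segment u j' (n + 1)}) := by
    rw [factors_eq_range]
    rintro _ ⟨m, rfl⟩
    simp only [Set.mem_image, Set.mem_sdiff, Set.mem_insert_iff, Set.mem_singleton_iff]
    by_cases hm : Agree u (n + 1) m i'
    · refine ⟨segment u i (n + 1), ⟨segment_mem_factors .., ?_⟩, ?_⟩
      · rw [segment_eq_iff, segment_eq_iff]
        rintro (h | h)
        · exact hi (h n (by omega))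
        · exact hne hii (fun _ _ => rfl) hii h
      · rw [dropLast_segment]
        exact segment_eq_iff.2 fun k hk => (hii k hk).trans (hm k (by omega)).symm
    by_cases hm' : Agree u (n + 1) m j'
    · refine ⟨segment u j (n + 1), ⟨segment_mem_factors .., ?_⟩, ?_⟩
      · rw [segment_eq_iff, segment_eq_iff]
        rintro (h | h)
        · exact hne (fun _ _ => rfl) hjj hii h.symm
        · exact hj (h n (by omega))
      · rw [dropLast_segment]
        exact segment_eq_iff.2 fun k hk => (hjj k hk).trans (hm' k (by omega)).symm
    exact ⟨_, ⟨segment_mem_factors u m _, by simp [segment_eq_iff, hm, hm']⟩,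
        dropLast_segment ..⟩
  have hfin := h.finite_factors (n + 1)
  have h1 := (Set.ncard_le_ncard hsub (hfin.sdiff.image _)).trans (Set.ncard_image_le hfin.sdiff)
  have h2 : ({segment u i' (n + 1), segment u j' (n + 1)} : Set (List A)).ncard = 2 :=
    Set.ncard_pair fun h => hne (fun _ _ => rfl) (fun _ _ => rfl) hii (segment_eq_iff.1 h)
  rw [Set.ncard_sdiff (by
    rintro _ (rfl | rfl) <;> exact segment_mem_factors ..) (Set.toFinite _), h2] at h1
  have h3 := h n
  have h4 := h (n + 1)
  unfold complexity at h3 h4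
  omega

/-! ### Powers and the index -/

lemma isPower_segment {M : ℕ} (hn : 0 < n) (hM : n ≤ M) :
    IsPower (segment u i M) (segment u j n) ↔ ∀ k, k < M → u (i + k) = u (j + k % n) := by
  have hne : segment u j n ≠ [] := by
    rw [← List.length_pos_iff, length_segment]; exact hn
  simp only [IsPower, length_segment, hne, hM, ne_eq, not_false_eq_true, true_and]
  refine forall₂_congr fun k hk => ?_
  rw [getElem?_segment hk, getElem?_segment (Nat.mod_lt _ hn), Option.some_inj]

lemma length_le_mul_ind {v w : List A} (hv : v ∈ language u) (h : IsPower v w) :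
    (v.length : ℝ≥0∞) ≤ w.length * ind u w := by
  have hw : (w.length : ℝ≥0∞) ≠ 0 := by
    simpa using h.1
  calc (v.length : ℝ≥0∞) = w.length * (v.length / w.length) :=
        (ENNReal.mul_div_cancel hw (by simp)).symm
    _ ≤ _ := by gcongr; exact le_sSup ⟨v, hv, h, rfl⟩

lemma mul_ind_eq {v w : List A} (hv : v ∈ language u) (h : IsPower v w)
    (hmax : ∀ v' ∈ language u, IsPower v' w → v'.length ≤ v.length) :
    (w.length : ℝ≥0∞) * ind u w = v.length := by
  refine le_antisymm ?_ (length_le_mul_ind hv h)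
  have hw : (w.length : ℝ≥0∞) ≠ 0 := by
    simpa using h.1
  calc (w.length : ℝ≥0∞) * ind u w ≤ w.length * (v.length / w.length) := by
        gcongr
        refine sSup_le ?_
        rintro _ ⟨v', hv', h', rfl⟩
        gcongr
        exact hmax v' hv' h'
    _ = _ := ENNReal.mul_div_cancel hw (by simp)

/-- If `R(|w|)` is finite and `R(|w|) = |w| ind(w) + 1`, then the index is attained. -/
lemma exists_isPower_of_mul_ind_add_one_eq {w : List A} {R : ℕ} (hw : w ≠ []) (hwl : w ∈ language u)
    (h : (R : ℝ≥0∞) = w.length * ind u w + 1) :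
    ∃ v ∈ language u, IsPower v w ∧ R = v.length + 1 := by
  classical
  have hbound : ∀ v ∈ language u, IsPower v w → v.length ≤ R := by
    intro v hv hp
    have := length_le_mul_ind hv hp
    have h2 : (v.length : ℝ≥0∞) ≤ R := by
      rw [h]; exact this.trans le_self_add
    exact_mod_cast h2
  have hself : IsPower w w := ⟨hw, le_rfl, fun i hi => by rw [Nat.mod_eq_of_lt hi]⟩
  let Q : ℕ → Prop := fun L => ∃ v ∈ language u, IsPower v w ∧ v.length = L
  have hQ : Q (Nat.findGreatest Q R) :=
    Nat.findGreatest_spec (hbound w hwl hself) ⟨w, hwl, hself, rfl⟩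
  obtain ⟨v, hv, hp, hlen⟩ := hQ
  refine ⟨v, hv, hp, ?_⟩
  rw [mul_ind_eq hv hp fun v' hv' hp' => ?_] at h
  · exact_mod_cast h
  · rw [hlen]
    exact Nat.le_findGreatest (hbound v' hv' hp') ⟨v', hv', hp', rfl⟩

/-- If every segment whose length is one more than that of a power of `w` contains all factors of
length `|w|`, then there are at most `|w| + 1` of these. -/
lemma complexity_le_of_recurrenceFunction_eq {v w : List A} (hv : v ∈ language u)
    (h : IsPower v w) (hR : recurrenceFunction u w.length = v.length + 1) :
    complexity u w.length ≤ w.length + 1 := by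
  have hmem : v.length + 1 ∈ {L | ∀ k, ∀ y ∈ factors u w.length, OccursInWindow u y k L} := by
    rw [← hR]
    -- An empty set would have infimum 0, which is not a successor.
    refine Nat.sInf_mem (Set.nonempty_iff_ne_empty.2 fun hempty => ?_)
    rw [recurrenceFunction, hempty, Nat.sInf_empty] at hR
    omega
  obtain ⟨i, hi⟩ := hv
  obtain ⟨hw, hle, hper⟩ := h
  have hpos : 0 < w.length := List.length_pos_iff.2 hw
  set n := w.length
  set M := v.length
  have hper' : ∀ k, k < M → u (i + k) = u (i + k % n) := by
    intro k hk
    have hk' : k % n < M := (Nat.mod_lt _ hpos).trans_le hle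
    have h1 := hper k hk
    have h2 := hper (k % n) hk'
    rw [← hi, getElem?_segment (by simpa using hk)] at h1
    rw [← hi, getElem?_segment (by simpa using hk')] at h2
    rw [Nat.mod_mod, ← h1, Option.some_inj] at h2
    exact h2.symm
  -- The first `n` positions represent all windows inside `v`; the extra one is the window that ends
  -- one letter beyond `v`.
  let T : Finset ℕ := insert (i + (M + 1 - n)) ((Finset.range n).image fun k => i + k)
  have hT : T.card ≤ n + 1 :=
    (Finset.card_insert_le _ _).trans (by simpa using Finset.card_image_le (s := Finset.range n))
  have hsub : factors u n ⊆ (fun j => segment u j n) '' (T : Set ℕ) := by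
    rw [factors_eq_range]
    rintro _ ⟨m, rfl⟩
    obtain ⟨j, hij, hj, hag⟩ := occursInWindow_segment.1 (hmem i _ (segment_mem_factors u m n))
    obtain ⟨k, rfl⟩ := Nat.exists_eq_add_of_le hij
    by_cases hk : k + n ≤ M
    · refine ⟨i + k % n, ?_, segment_eq_iff.2 fun t ht => ?_⟩
      · simp only [T, Finset.coe_insert, Finset.coe_image, Finset.coe_range]
        exact Or.inr ⟨k % n, Nat.mod_lt _ hpos, rfl⟩
      · have hkm := Nat.mod_le k n
        rw [← hag t ht, add_assoc, add_assoc, hper' _ (by omega), hper' (k + t) (by omega),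
          Nat.mod_add_mod]
    · refine ⟨i + k, ?_, segment_eq_iff.2 hag⟩
      rw [show k = M + 1 - n by omega]
      simp [T]
  calc complexity u n ≤ _ := Set.ncard_le_ncard hsub (T.finite_toSet.image _)
    _ ≤ _ := Set.ncard_image_le T.finite_toSet
    _ ≤ n + 1 := by rwa [Set.ncard_coe_finset]

/-! ### Shortest return times -/

/-- `n` is the shortest return time of the factors of length `K` of `u`, and the window of
length `K` at position `s` returns after `n` steps. Moreover `2 ≤ n ≤ K`. -/
structure IsShortestReturn (u : ℕ → A) (K n s : ℕ) : Prop where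
  two_le : 2 ≤ n
  le : n ≤ K
  agree : Agree u K (s + n) s
  not_agree : ∀ e i, 0 < e → e < n → ¬ Agree u K (i + e) i

/-- Otherwise any `K + 1` consecutive windows are distinct and exhaust the factors. The window at
`i` must then recur at exactly `i + K + 1`, so `u` has period `K + 1`. -/
lemma IsSturmian.exists_return_le (h : IsSturmian u) (haper : IsAperiodic u) (hK : 0 < K) :
    ∃ e, 0 < e ∧ e ≤ K ∧ ∃ i, Agree u K (i + e) i := by
  by_contra! hcon
  refine haper ⟨K + 1, by omega, 0, fun i _ => ?_⟩
  have hinj : Set.InjOn (fun j => segment u j K) (Finset.Icc (i + 1) (i + K + 1) : Set ℕ) := by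
    intro a ha b hb hab
    rw [Finset.coe_Icc, Set.mem_Icc] at ha hb
    simp only [segment_eq_iff] at hab
    by_contra hne
    rcases lt_or_gt_of_ne hne with hlt | hlt
    · refine hcon (b - a) (by omega) (by omega) a ?_
      rw [show a + (b - a) = b by omega]; exact hab.symm
    · refine hcon (a - b) (by omega) (by omega) b ?_
      rw [show b + (a - b) = a by omega]; exact hab
  have hcov : (fun j => segment u j K) '' (Finset.Icc (i + 1) (i + K + 1) : Set ℕ) =
      factors u K := by
    refine Set.eq_of_subset_of_ncard_le ?_ ?_ (h.finite_factors K)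
    · rintro _ ⟨m, -, rfl⟩
      exact segment_mem_factors u m K
    · have := h K
      unfold complexity at this
      rw [hinj.ncard_image, Set.ncard_coe_finset, this, Nat.card_Icc]
      omega
  obtain ⟨m, hm, hag⟩ := hcov.ge (segment_mem_factors u i K)
  rw [Finset.coe_Icc, Set.mem_Icc] at hm
  have hag := segment_eq_iff.1 hag
  by_cases hmK : m ≤ i + K
  · refine absurd ?_ (hcon (m - i) (by omega) (by omega) i)
    rwa [show i + (m - i) = m by omega]
  · have := hag 0 hK
    rwa [add_zero, add_zero, show m = i + (K + 1) by omega] at this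

/-- If stretches of a fixed period were arbitrarily long, they would contain every short factor by
uniform recurrence, and `u` itself would have that period. -/
lemma IsUniformlyRecurrent.exists_not_agree (hrec : IsUniformlyRecurrent u)
    (haper : IsAperiodic u) (N : ℕ) :
    ∃ K, ∀ e i, 0 < e → e ≤ N → ¬ Agree u K (i + e) i := by
  induction N with
  | zero => exact ⟨0, fun e i h1 h2 => by omega⟩
  | succ N ih =>
    obtain ⟨K, hK⟩ := ih
    obtain ⟨K', hK'⟩ : ∃ K', ∀ i, ¬ Agree u K' (i + (N + 1)) i := by
      by_contra! hcon
      refine haper ⟨N + 1, by omega, 0, fun k _ => ?_⟩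
      obtain ⟨L, hL⟩ := hrec _ (segment_mem_language u k (N + 2))
      obtain ⟨i, hi⟩ := hcon L
      obtain ⟨j, hj, hjL, hag⟩ := occursInWindow_segment.1 (hL i)
      have h0 := hag 0 (by omega)
      have h1 := hag (N + 1) (by omega)
      have h2 := hi (j - i) (by omega)
      rw [show i + (N + 1) + (j - i) = j + (N + 1) by omega, show i + (j - i) = j by omega] at h2
      rw [← h1, h2]
      exact h0
    refine ⟨max K K', fun e i h1 h2 hag => ?_⟩
    rcases Nat.le_succ_iff.mp h2 with h2 | rfl
    · exact hK e i h1 h2 (hag.mono (le_max_left ..))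
    · exact hK' i (hag.mono (le_max_right ..))

lemma IsSturmian.exists_isShortestReturn (h : IsSturmian u) (hrec : IsUniformlyRecurrent u)
    (haper : IsAperiodic u) (N : ℕ) : ∃ K n s, N ≤ n ∧ IsShortestReturn u K n s := by
  classical
  obtain ⟨K, hK⟩ := hrec.exists_not_agree haper (N + 1)
  have hex := h.exists_return_le haper K.succ_pos
  obtain ⟨hpos, hle, s, hs⟩ := Nat.find_spec hex
  set n := Nat.find hex with hn
  have hN : N + 1 < n := by
    by_contra! hcon
    exact hK n s hpos hcon (hs.mono K.le_succ)
  refine ⟨K + 1, n, s, by omega, by omega, hle, hs, fun e i h1 h2 hag => ?_⟩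
  exact Nat.find_min hex h2 ⟨h1, by omega, i, hag⟩

/-! ### The cycle of a shortest return -/

/-- The cyclic word `u_s u_{s+1} ⋯ u_{s+n-1}`. -/
def cyclicWord (u : ℕ → A) (s n : ℕ) (z : ZMod n) : A :=
  u (s + z.val)

/-- The window of length `n` at position `i` is the conjugate of `u_s u_{s+1} ⋯ u_{s+n-1}` that
starts at `c`. -/
def ReadsAt (u : ℕ → A) (s n : ℕ) (c : ZMod n) (i : ℕ) : Prop :=
  ∀ k < n, u (i + k) = cyclicWord u s n (c + k)

/-- The window of length `n` at position `i` is a conjugate of `u_s u_{s+1} ⋯ u_{s+n-1}`. -/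
def OnCycle (u : ℕ → A) (s n i : ℕ) : Prop :=
  ∃ c, ReadsAt u s n c i

lemma ReadsAt.agree {c : ZMod n} (hi : ReadsAt u s n c i) (hj : ReadsAt u s n c j) :
    Agree u n i j :=
  fun k hk => (hi k hk).trans (hj k hk).symm

lemma ReadsAt.of_agree {c : ZMod n} (hi : ReadsAt u s n c i) (h : Agree u n i j) :
    ReadsAt u s n c j :=
  fun k hk => (h k hk).symm.trans (hi k hk)

lemma OnCycle.of_agree (hi : OnCycle u s n i) (h : Agree u n i j) : OnCycle u s n j :=
  let ⟨c, hc⟩ := hi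
  ⟨c, hc.of_agree h⟩

/-- If the shift of a function on `ZMod n` by `e` agrees with the function at all but one place,
then it agrees everywhere. -/
lemma periodic_of_forall_ne {n : ℕ} (f : ZMod n → A) (e b : ZMod n) [NeZero n]
    (h : ∀ t, t ≠ b → f (t + e) = f t) (t : ZMod n) : f (t + e) = f t := by
  by_cases ht : t = b
  swap
  · exact h t ht
  subst ht
  by_contra hne
  -- Walk along the orbit of `t` from `t + e`. It avoids the exceptional place until it closes up at
  -- `t`.
  have key : ∀ m : ℕ, f (t + (m + 1) * e) = f (t + e) := by
    intro m
    induction m with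
    | zero => simp
    | succ m ih =>
      have : t + (m + 1) * e ≠ t := fun h' => hne (by rw [← ih, h'])
      rw [← ih, ← h _ this]
      push_cast
      ring_nf
  have := key (n - 1)
  rw [Nat.cast_sub (Nat.one_le_iff_ne_zero.2 (NeZero.ne n))] at this
  simp only [CharP.cast_eq_zero, Nat.cast_one, zero_sub, neg_add_cancel, zero_mul, add_zero] at this
  exact hne this.symm

lemma exists_natCast_of_ne_sub_one {n : ℕ} [NeZero n] (c t : ZMod n) (h : t ≠ c - 1) :
    ∃ k : ℕ, k + 1 < n ∧ t = c + k := by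
  refine ⟨(t - c).val, ?_, by simp⟩
  have hlt := ZMod.val_lt (t - c)
  by_contra hcon
  refine h ?_
  have h1 : (t - c).val + 1 = n := by omega
  have h2 := congrArg (Nat.cast : ℕ → ZMod n) h1
  simp only [Nat.cast_add, ZMod.natCast_val, ZMod.cast_id', id_eq, Nat.cast_one,
    CharP.cast_eq_zero] at h2
  linear_combination h2


/-! ### Reading along the cycle -/

namespace IsShortestReturn

lemma pos (h : IsShortestReturn u K n s) : 0 < n := by have := h.two_le; omega

lemma neZero (h : IsShortestReturn u K n s) : NeZero n := ⟨h.pos.ne'⟩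

lemma apply_eq (h : IsShortestReturn u K n s) {m t : ℕ} (hm : Agree u m (s + n) s)
    (ht : t < m + n) : u (s + t) = cyclicWord u s n t := by
  induction t using Nat.strong_induction_on with
  | _ t ih =>
    by_cases htn : t < n
    · rw [cyclicWord, ZMod.val_natCast, Nat.mod_eq_of_lt htn]
    · have := hm (t - n) (by omega)
      rw [show s + n + (t - n) = s + t by omega, ih (t - n) (by
        have := h.pos; omega) (by omega)] at this
      rw [this, Nat.cast_sub (by omega), CharP.cast_eq_zero (ZMod n) n, sub_zero]

/-- A nontrivial period of the cyclic word would be a return time of the window at `s` smaller than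
`n`. -/
lemma not_periodic (h : IsShortestReturn u K n s) {e : ZMod n}
    (hp : ∀ t, cyclicWord u s n (t + e) = cyclicWord u s n t) : e = 0 := by
  have := h.neZero
  by_contra hne
  have hlt := ZMod.val_lt e
  refine h.not_agree e.val s (Nat.pos_of_ne_zero ((ZMod.val_ne_zero e).2 hne)) hlt fun k hk => ?_
  rw [add_assoc, h.apply_eq h.agree (t := e.val + k) (by omega),
    h.apply_eq h.agree (t := k) (by omega), ← hp k]
  congr 1
  push_cast
  rw [ZMod.natCast_zmod_val, add_comm]

lemma readsAt_unique (h : IsShortestReturn u K n s) {c c' : ZMod n} (hc : ReadsAt u s n c i)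
    (hc' : ReadsAt u s n c' i) : c = c' := by
  have := h.neZero
  refine (sub_eq_zero.1 (h.not_periodic (e := c' - c) fun t => ?_)).symm
  have hlt := ZMod.val_lt (t - c)
  have := (hc' _ hlt).symm.trans (hc _ hlt)
  rw [ZMod.natCast_zmod_val] at this
  convert this using 2 <;> ring

/-- The two readings share `n - 1` letters, so shifting the cyclic word by their difference changes
it at most at one place, hence nowhere. -/
lemma readsAt_succ (h : IsShortestReturn u K n s) {c : ZMod n} (hc : ReadsAt u s n c i)
    (hi : OnCycle u s n (i + 1)) : ReadsAt u s n (c + 1) (i + 1) := by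
  have := h.neZero
  obtain ⟨c', hc'⟩ := hi
  have key := periodic_of_forall_ne (cyclicWord u s n) (c' - (c + 1)) c fun t ht => by
    obtain ⟨k, hk, rfl⟩ := exists_natCast_of_ne_sub_one (c + 1) t (by simpa using ht)
    have h1 := hc' k (by omega)
    have h2 := hc (k + 1) hk
    rw [show i + (k + 1) = i + 1 + k by ring, h1] at h2
    convert h2 using 2
    · ring
    · push_cast; ring
  intro k hk
  rw [hc' k hk, ← key (c + 1 + k)]
  congr 1
  ring

/-- Along the cycle, the word has period `n`. -/
lemma apply_add_eq (h : IsShortestReturn u K n s) (hi : OnCycle u s n i)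
    (hi' : OnCycle u s n (i + 1)) : u (i + n) = u i := by
  obtain ⟨c, hc⟩ := hi
  have hpos := h.pos
  have h1 := h.readsAt_succ hc hi' (n - 1) (by omega)
  have h2 := hc 0 hpos
  rw [show i + 1 + (n - 1) = i + n by omega] at h1
  rw [h1]
  rw [add_zero] at h2
  rw [h2]
  congr 1
  rw [Nat.cast_sub (by omega), CharP.cast_eq_zero]
  push_cast
  ring

lemma readsAt_add (h : IsShortestReturn u K n s) {c : ZMod n} (hc : ReadsAt u s n c i) (m : ℕ)
    (hm : ∀ t, t ≤ m → OnCycle u s n (i + t)) : ReadsAt u s n (c + m) (i + m) := by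
  induction m with
  | zero => simpa using hc
  | succ m ih =>
    have := h.readsAt_succ (ih fun t ht => hm t (by omega)) (hm (m + 1) le_rfl)
    push_cast
    rwa [← add_assoc]

/-- Any `n` consecutive windows on the cycle exhaust the cycle. -/
lemma exists_readsAt (h : IsShortestReturn u K n s) (hi : ∀ t, t < n → OnCycle u s n (i + t))
    (c : ZMod n) : ∃ t, t < n ∧ ReadsAt u s n c (i + t) := by
  have := h.neZero
  obtain ⟨c₀, hc₀⟩ := hi 0 h.pos
  have hlt := ZMod.val_lt (c - c₀)
  refine ⟨(c - c₀).val, hlt, ?_⟩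
  have := h.readsAt_add hc₀ (c - c₀).val fun t ht => hi t (by omega)
  rwa [ZMod.natCast_zmod_val, add_sub_cancel] at this

/-- As `n ≤ K`, the stretch has length at least `2 * n`, enough for a full turn including `t = n`.
-/
lemma readsAt_start (h : IsShortestReturn u K n s) {t : ℕ} (ht : t ≤ n) :
    ReadsAt u s n t (s + t) := by
  intro k hk
  have := h.le
  rw [add_assoc, h.apply_eq h.agree (by omega)]
  push_cast
  rfl

lemma ncard_conjugates (h : IsShortestReturn u K n s) :
    (Set.range fun c : ZMod n => segment u (s + c.val) n).ncard = n := by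
  have := h.neZero
  rw [← Set.image_univ, Set.InjOn.ncard_image, Set.ncard_univ, Nat.card_zmod]
  intro c _ c' _ hcc
  have h1 := h.readsAt_start (ZMod.val_lt c).le
  have h2 := h.readsAt_start (ZMod.val_lt c').le
  rw [ZMod.natCast_zmod_val] at h1 h2
  exact h.readsAt_unique (h1.of_agree (segment_eq_iff.1 hcc)) h2

lemma onCycle_iff (h : IsShortestReturn u K n s) :
    OnCycle u s n i ↔ segment u i n ∈ Set.range fun c : ZMod n => segment u (s + c.val) n := by
  have := h.neZero
  constructor
  · rintro ⟨c, hc⟩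
    have h1 := h.readsAt_start (ZMod.val_lt c).le
    rw [ZMod.natCast_zmod_val] at h1
    exact ⟨c, segment_eq_iff.2 (h1.agree hc)⟩
  · rintro ⟨c, hc⟩
    exact ⟨_, (h.readsAt_start (ZMod.val_lt c).le).of_agree (segment_eq_iff.1 hc)⟩

/-! ### The single factor outside the cycle -/

lemma exists_not_onCycle (h : IsShortestReturn u K n s) (hu : IsSturmian u) :
    ∃ i, ¬ OnCycle u s n i := by
  have := h.neZero
  by_contra! hcon
  have hsub : factors u n ⊆ Set.range fun c : ZMod n => segment u (s + c.val) n := by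
    rw [factors_eq_range]
    rintro _ ⟨m, rfl⟩
    exact h.onCycle_iff.1 (hcon m)
  have h1 := Set.ncard_le_ncard hsub (Set.finite_range _)
  have h2 := hu n
  rw [h.ncard_conjugates] at h1
  unfold complexity at h2
  omega

/-- A Sturmian word has only one factor of length `n` that is not on the cycle. -/
lemma agree_of_not_onCycle (h : IsShortestReturn u K n s) (hu : IsSturmian u)
    (hi : ¬ OnCycle u s n i) (hj : ¬ OnCycle u s n j) : Agree u n i j := by
  have := h.neZero
  rw [h.onCycle_iff] at hi hj
  rw [← segment_eq_iff]
  by_contra hne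
  have hsub : insert (segment u i n) (insert (segment u j n)
      (Set.range fun c : ZMod n => segment u (s + c.val) n)) ⊆ factors u n := by
    rw [factors_eq_range]
    rintro _ (rfl | rfl | ⟨c, rfl⟩) <;> exact ⟨_, rfl⟩
  have h1 := Set.ncard_le_ncard hsub (hu.finite_factors n)
  rw [Set.ncard_insert_of_notMem (by
      rw [Set.mem_insert_iff]; exact not_or.2 ⟨hne, hi⟩) (Set.toFinite _),
    Set.ncard_insert_of_notMem hj (Set.toFinite _), h.ncard_conjugates] at h1
  have h2 := hu n
  unfold complexity at h2
  omega

/-- The stretch at `s` shows the continuation along the cycle; leaving it requires a different next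
letter. -/
lemma isRightSpecial_of_not_onCycle_succ (h : IsShortestReturn u K n s)
    (hi : OnCycle u s n i) (hi' : ¬ OnCycle u s n (i + 1)) : IsRightSpecial u n i := by
  have := h.neZero
  obtain ⟨c, hc⟩ := hi
  have hlt := ZMod.val_lt c
  have h1 := h.readsAt_start hlt.le
  have h2 := h.readsAt_start (t := c.val + 1) hlt
  rw [ZMod.natCast_zmod_val] at h1
  have hag := hc.agree h1
  refine ⟨_, hag, fun heq => hi' ⟨_, h2.of_agree ?_⟩⟩
  exact (hag.shift heq).symm

/-- The predecessor on the cycle of the factor outside the cycle is unique. -/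
lemma agree_of_not_onCycle_succ (h : IsShortestReturn u K n s) (hu : IsSturmian u)
    (hi : OnCycle u s n i) (hi' : ¬ OnCycle u s n (i + 1))
    (hj : OnCycle u s n j) (hj' : ¬ OnCycle u s n (j + 1)) : Agree u n i j :=
  hu.agree_of_isRightSpecial (h.isRightSpecial_of_not_onCycle_succ hi hi')
    (h.isRightSpecial_of_not_onCycle_succ hj hj')

lemma exists_not_onCycle_bounded (h : IsShortestReturn u K n s) (hu : IsSturmian u)
    (hrec : IsUniformlyRecurrent u) : ∃ L, ∀ k, ∃ j, k ≤ j ∧ j ≤ k + L ∧ ¬ OnCycle u s n j := by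
  obtain ⟨i, hi⟩ := h.exists_not_onCycle hu
  obtain ⟨L, hL⟩ := hrec _ (segment_mem_language u i n)
  refine ⟨L, fun k => ?_⟩
  obtain ⟨j, hj, hjL, hag⟩ := occursInWindow_segment.1 (hL k)
  exact ⟨j, hj, by omega, fun h' => hi (h'.of_agree hag)⟩

lemma exists_exit (h : IsShortestReturn u K n s) (hu : IsSturmian u)
    (hrec : IsUniformlyRecurrent u) : ∃ r, OnCycle u s n r ∧ ¬ OnCycle u s n (r + 1) := by
  obtain ⟨L, hL⟩ := h.exists_not_onCycle_bounded hu hrec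
  by_contra! hcon
  have hall : ∀ t, OnCycle u s n (s + t) := by
    intro t
    induction t with
    | zero => exact ⟨_, h.readsAt_start (t := 0) (Nat.zero_le n)⟩
    | succ t ih => exact hcon _ ih
  obtain ⟨j, hj, -, hj'⟩ := hL s
  obtain ⟨t, rfl⟩ := Nat.exists_eq_add_of_le hj
  exact hj' (hall t)

/-- The factor outside the cycle is not right special. -/
lemma apply_add_eq_of_not_onCycle (h : IsShortestReturn u K n s) (hu : IsSturmian u)
    (hrec : IsUniformlyRecurrent u) (hi : ¬ OnCycle u s n i) (hj : ¬ OnCycle u s n j) :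
    u (i + n) = u (j + n) := by
  by_contra hne
  obtain ⟨r, hr, hr'⟩ := h.exists_exit hu hrec
  exact hi (hr.of_agree (hu.agree_of_isRightSpecial
    (h.isRightSpecial_of_not_onCycle_succ hr hr') ⟨j, h.agree_of_not_onCycle hu hi hj, hne⟩))

/-- The factor outside the cycle does not return within `n` steps. -/
lemma add_lt_of_not_onCycle (h : IsShortestReturn u K n s) (hu : IsSturmian u)
    (haper : IsAperiodic u) (hi : ¬ OnCycle u s n i)
    (hj : ¬ OnCycle u s n j) (hij : i < j) : i + n < j := by
  classical
  have hpos := h.pos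
  have hn2 := h.two_le
  have := h.neZero
  by_contra! hle
  have hex : ∃ e, 0 < e ∧ ¬ OnCycle u s n (i + e) :=
    ⟨j - i, by omega, by rwa [show i + (j - i) = j by omega]⟩
  obtain ⟨he, hie⟩ := Nat.find_spec hex
  have hen : Nat.find hex ≤ j - i :=
    Nat.find_min' hex ⟨by omega, by rwa [show i + (j - i) = j by omega]⟩
  have hmin : ∀ t, 0 < t → t < Nat.find hex → OnCycle u s n (i + t) := fun t h1 h2 => by
    have := Nat.find_min hex h2
    tauto
  generalize Nat.find hex = e at he hie hen hmin
  have hret := h.agree_of_not_onCycle hu hie hi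
  rcases (show e ≤ n by omega).eq_or_lt with rfl | hen
  -- If the return takes exactly `n` steps, the window at `i` is a rotation of the one at `i + 1`,
  -- which is on the cycle.
  · obtain ⟨c, hc⟩ := hmin 1 one_pos (by omega)
    refine hi ⟨c - 1, fun k hk => ?_⟩
    rcases Nat.eq_zero_or_pos k with rfl | hk0
    · rw [← hret 0 hpos]
      have := hc (e - 1) (by omega)
      rw [show i + 1 + (e - 1) = i + e + 0 by omega] at this
      rw [this, Nat.cast_sub (by omega), CharP.cast_eq_zero]
      congr 1
      push_cast
      ring
    · have := hc (k - 1) (by omega)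
      rw [show i + 1 + (k - 1) = i + k by omega] at this
      rw [this, Nat.cast_sub (by omega)]
      congr 1
      push_cast
      ring
  -- Period `e` persists up to `n + e - 1`: a failure would make an earlier window right special,
  -- hence equal to the exit window at `i + e - 1`. But the first window is off the cycle, and the
  -- others differ from the exit by less than a full turn.
  · have hlong : Agree u (n + e - 1) (i + e) i := by
      intro b
      induction b using Nat.strong_induction_on with
      | _ b ih =>
        intro hb
        by_cases hbn : b < n
        · exact hret b hbn
        obtain ⟨b, rfl⟩ := Nat.exists_eq_add_of_le' (not_lt.1 hbn)
        have hag : Agree u n (i + b) (i + e + b) := by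
          intro k hk
          have := ih (b + k) (by omega) (by omega)
          rw [← add_assoc, ← add_assoc] at this
          exact this.symm
        by_contra hne
        have hrs : IsRightSpecial u n (i + b) :=
          ⟨i + e + b, hag, fun h' => hne (by rw [← add_assoc, ← add_assoc]; exact h'.symm)⟩
        have hlast := hmin (e - 1) (by omega) (by omega)
        have hexit := h.isRightSpecial_of_not_onCycle_succ hlast
          (by rwa [show i + (e - 1) + 1 = i + e by omega])
        have hag' := hu.agree_of_isRightSpecial hexit hrs
        rcases Nat.eq_zero_or_pos b with rfl | hb0
        · exact hi (hlast.of_agree hag')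
        · obtain ⟨c, hc⟩ := hmin b hb0 (by omega)
          have h1 := h.readsAt_add hc (e - 1 - b) fun t ht => by
            rw [add_assoc]; exact hmin _ (by omega) (by omega)
          rw [show i + b + (e - 1 - b) = i + (e - 1) by omega] at h1
          have h2 := h.readsAt_unique hc (h1.of_agree hag')
          rw [left_eq_add, ZMod.natCast_eq_zero_iff] at h2
          have := Nat.le_of_dvd (by omega) h2
          omega
    rcases le_or_gt K (n + e - 1) with hK | hK
    · exact h.not_agree e i he hen (hlong.mono hK)
    -- The stretches of periods `e` and `n` end in the same right special factor of length `n + e -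
    -- 1`. Its two periods give `e`-periodicity of the cyclic word at all but one place.
    · obtain ⟨a, ha, hrs⟩ := haper.exists_isRightSpecial he hlong
      obtain ⟨a', ha', hrs'⟩ := haper.exists_isRightSpecial hpos (h.agree.mono hK.le)
      have hag := hu.agree_of_isRightSpecial hrs' hrs
      have key := periodic_of_forall_ne (cyclicWord u s n) e ((a' : ZMod n) - 1) fun t ht => by
        obtain ⟨k, hk, rfl⟩ := exists_natCast_of_ne_sub_one _ t ht
        have h1 := hag k (by omega)
        have h2 := hag (k + e) (by omega)
        have h3 := ha (a + k) (by omega)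
        rw [show i + e + (a + k) = i + a + (k + e) by omega, ← h2, ← add_assoc i, ← h1, add_assoc,
          add_assoc, h.apply_eq ha' (by omega), h.apply_eq ha' (by omega)] at h3
        push_cast at h3
        rwa [add_assoc]
      have h0 := h.not_periodic key
      rw [ZMod.natCast_eq_zero_iff] at h0
      have := Nat.le_of_dvd he h0
      omega

/-- Outside the cycle, the word is determined to the right until the next exit from the cycle. -/
lemma agree_add (h : IsShortestReturn u K n s) (hu : IsSturmian u)
    (hrec : IsUniformlyRecurrent u) (hi : ¬ OnCycle u s n i) (hj : ¬ OnCycle u s n j) (m : ℕ)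
    (hi' : ∀ t, 0 < t → t ≤ m → OnCycle u s n (i + t))
    (hj' : ∀ t, 0 < t → t ≤ m → OnCycle u s n (j + t)) : Agree u n (i + m) (j + m) := by
  induction m with
  | zero => exact h.agree_of_not_onCycle hu hi hj
  | succ m ih =>
    have hag := ih (fun t h0 ht => hi' t h0 (by omega)) (fun t h0 ht => hj' t h0 (by omega))
    refine hag.shift ?_
    rcases Nat.eq_zero_or_pos m with rfl | hm
    · exact h.apply_add_eq_of_not_onCycle hu hrec hi hj
    · rw [h.apply_add_eq (hi' m hm (by omega)) (hi' (m + 1) (by omega) le_rfl),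
        h.apply_add_eq (hj' m hm (by omega)) (hj' (m + 1) (by omega) le_rfl)]
      exact hag 0 h.pos

/-- On the cycle, the past of the factor outside the cycle is determined. -/
lemma agree_of_not_onCycle_add (h : IsShortestReturn u K n s) (hu : IsSturmian u) (m : ℕ)
    (hm : 0 < m) (hi : ∀ t, t < m → OnCycle u s n (i + t)) (hi' : ¬ OnCycle u s n (i + m))
    (hj : ∀ t, t < m → OnCycle u s n (j + t)) (hj' : ¬ OnCycle u s n (j + m)) :
    Agree u n i j := by
  induction m, hm using Nat.le_induction generalizing i j with
  | base => exact h.agree_of_not_onCycle_succ hu (hi 0 one_pos) hi' (hj 0 one_pos) hj'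
  | succ m hm ih =>
    have hpos := h.pos
    have hag : Agree u n (i + 1) (j + 1) := by
      refine ih (fun t ht => ?_) ?_ (fun t ht => ?_) ?_
      · have := hi (t + 1) (by omega); rwa [add_assoc, add_comm 1]
      · rwa [add_assoc, add_comm 1]
      · have := hj (t + 1) (by omega); rwa [add_assoc, add_comm 1]
      · rwa [add_assoc, add_comm 1]
    intro k hk
    rcases Nat.eq_zero_or_pos k with rfl | hk0
    -- Along the cycle, the last letter of the next window equals the first letter of this one.
    · have h1 := hag (n - 1) (by omega)
      rw [show i + 1 + (n - 1) = i + n by omega, show j + 1 + (n - 1) = j + n by omega,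
        h.apply_add_eq (i := i) (hi 0 (by omega)) (hi 1 (by omega)),
        h.apply_add_eq (i := j) (hj 0 (by omega)) (hj 1 (by omega))] at h1
      exact h1
    · have h1 := hag (k - 1) (by omega)
      rwa [show i + 1 + (k - 1) = i + k by omega, show j + 1 + (k - 1) = j + k by omega] at h1

/-! ### Longest runs, recurrence function and index -/

/-- A longest run along the cycle. -/
lemma exists_longest_run (h : IsShortestReturn u K n s) (hu : IsSturmian u)
    (hrec : IsUniformlyRecurrent u) :
    ∃ k N, ¬ OnCycle u s n k ∧ (∀ t, 0 < t → t ≤ N → OnCycle u s n (k + t)) ∧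
      ¬ OnCycle u s n (k + N + 1) ∧
      ∀ j N', (∀ t, t < N' → OnCycle u s n (j + t)) → N' ≤ N := by
  classical
  obtain ⟨L, hL⟩ := h.exists_not_onCycle_bounded hu hrec
  let Q : ℕ → Prop := fun N => ∃ k, ∀ t, t < N → OnCycle u s n (k + t)
  have hQL : ∀ N, Q N → N ≤ L := by
    rintro N ⟨k, hk⟩
    obtain ⟨j, hj, hjL, hj'⟩ := hL k
    by_contra! hlt
    obtain ⟨t, rfl⟩ := Nat.exists_eq_add_of_le hj
    exact hj' (hk t (by omega))
  set N := Nat.findGreatest Q L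
  have hmax : ∀ N', Q N' → N' ≤ N := fun N' hN' => Nat.le_findGreatest (hQL _ hN') hN'
  obtain ⟨k, hk⟩ : Q N := Nat.findGreatest_spec (m := 0) (Nat.zero_le L)
    ⟨0, fun t ht => absurd ht (Nat.not_lt_zero t)⟩
  -- The run found may start at position 0; an occurrence at a position at least 1 has a window
  -- before it.
  obtain ⟨L', hL'⟩ := hrec _ (segment_mem_language u k (N + n))
  obtain ⟨j, hj, -, hag⟩ := occursInWindow_segment.1 (hL' 1)
  obtain ⟨j, rfl⟩ := Nat.exists_eq_add_of_le' hj
  have hrun : ∀ t, t < N → OnCycle u s n (j + 1 + t) := fun t ht =>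
    (hk t ht).of_agree fun b hb => by
      rw [add_assoc, add_assoc]; exact (hag (t + b) (by omega)).symm
  refine ⟨j, N, fun hcon => ?_, fun t h0 ht => ?_, fun hcon => ?_, fun j N' hN' => hmax _ ⟨j, hN'⟩⟩
  · have : N + 1 ≤ N := hmax _ ⟨j, fun t ht => by
      rcases Nat.eq_zero_or_pos t with rfl | h0
      · exact hcon
      · have := hrun (t - 1) (by omega)
        rwa [show j + 1 + (t - 1) = j + t by omega] at this⟩
    omega
  · have := hrun (t - 1) (by omega)
    rwa [show j + 1 + (t - 1) = j + t by omega] at this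
  · have : N + 1 ≤ N := hmax _ ⟨j + 1, fun t ht => by
      rcases Nat.lt_succ_iff_lt_or_eq.mp ht with ht | rfl
      · exact hrun t ht
      · rwa [show j + 1 + N = j + N + 1 by omega]⟩
    omega

/-- Every segment that is one letter longer than a longest run along the cycle contains all the
factors of length `n`. -/
lemma exists_agree_of_longest_run (h : IsShortestReturn u K n s) (hu : IsSturmian u)
    (hrec : IsUniformlyRecurrent u) (haper : IsAperiodic u) {k N : ℕ} (hk : ¬ OnCycle u s n k)
    (hrun : ∀ t, 0 < t → t ≤ N → OnCycle u s n (k + t)) (hkN : ¬ OnCycle u s n (k + N + 1))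
    (hmax : ∀ j N', (∀ t, t < N' → OnCycle u s n (j + t)) → N' ≤ N) (i j : ℕ) :
    ∃ t, t ≤ N ∧ Agree u n (j + t) i := by
  have hnN : n ≤ N := by
    have := h.add_lt_of_not_onCycle hu haper hk hkN (by omega)
    omega
  obtain ⟨a, haN, ha⟩ : ∃ a, a ≤ N ∧ ¬ OnCycle u s n (j + a) := by
    by_contra! hcon
    have := hmax j (N + 1) fun t ht => hcon t (by omega)
    omega
  by_cases hi : OnCycle u s n i
  swap
  · exact ⟨a, haN, h.agree_of_not_onCycle hu ha hi⟩
  obtain ⟨c, hc⟩ := hi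
  by_cases htwo : ∃ b b', b < b' ∧ b' ≤ N ∧ ¬ OnCycle u s n (j + b) ∧ ¬ OnCycle u s n (j + b')
  · obtain ⟨b, b', hbb, hbN, hb, hb'⟩ := htwo
    have hgap := h.add_lt_of_not_onCycle hu haper hb hb' (by omega)
    -- The gap after an occurrence of the exceptional factor contains a full turn.
    obtain ⟨t, ht, hct⟩ := h.exists_readsAt (i := j + b + 1) (fun t ht => by
      by_contra hcon
      have := h.add_lt_of_not_onCycle hu haper hb hcon (by omega)
      omega) c
    refine ⟨b + 1 + t, by omega, ?_⟩
    rw [← add_assoc, ← add_assoc]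
    exact hct.agree hc
  · have honly : ∀ b, b ≤ N → b ≠ a → OnCycle u s n (j + b) := by
      intro b hbN hba
      by_contra hb
      rcases lt_or_gt_of_ne hba with hlt | hlt
      · exact htwo ⟨b, a, hlt, haN, hb, ha⟩
      · exact htwo ⟨a, b, hlt, hbN, ha, hb⟩
    -- With one exceptional window, the part after it copies the start of the longest run and the
    -- part before it copies the end. Together they cover the run.
    obtain ⟨t, ht, hct⟩ := h.exists_readsAt (i := k + 1) (fun t ht => by
      rw [add_assoc]; exact hrun _ (by omega) (by omega)) c
    by_cases hta : t + 1 ≤ N - a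
    · refine ⟨a + (t + 1), by omega, ?_⟩
      have := h.agree_add hu hrec ha hk (t + 1)
        (fun b h0 hb => by rw [add_assoc]; exact honly _ (by omega) (by omega))
        (fun b h0 hb => hrun b h0 (by omega))
      rw [show k + (t + 1) = k + 1 + t by omega] at this
      rw [← add_assoc]
      exact this.trans (hct.agree hc)
    -- The window wanted lies `N - t` steps before the end of the run, so it is sought `N - t` steps
    -- before `j + a`.
    · refine ⟨t + a - N, by omega, ?_⟩
      refine (h.agree_of_not_onCycle_add hu (N - t) (by omega) (fun b hb => ?_) ?_
        (fun b hb => ?_) ?_).trans (hct.agree hc)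
      · rw [add_assoc]; exact honly _ (by omega) (by omega)
      · rwa [show j + (t + a - N) + (N - t) = j + a by omega]
      · rw [show k + 1 + t + b = k + (1 + t + b) by omega]; exact hrun _ (by omega) (by omega)
      · rwa [show k + 1 + t + (N - t) = k + N + 1 by omega]

/-- The length of a longest run along the cycle gives the recurrence function and an index. -/
lemma exists_recurrenceFunction_eq (h : IsShortestReturn u K n s) (hu : IsSturmian u)
    (hrec : IsUniformlyRecurrent u) (haper : IsAperiodic u) :
    ∃ w ∈ language u, w.length = n ∧
      (recurrenceFunction u w.length : ℝ≥0∞) = w.length * ind u w + 1 := by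
  obtain ⟨k, N, hk, hrun, hkN, hmax⟩ := h.exists_longest_run hu hrec
  have hpos := h.pos
  have hnN : n ≤ N := by
    have := h.add_lt_of_not_onCycle hu haper hk hkN (by omega)
    omega
  have hpow : IsPower (segment u (k + 1) (N + n - 1)) (segment u (k + 1) n) := by
    rw [isPower_segment hpos (by omega)]
    intro t
    induction t using Nat.strong_induction_on with
    | _ t ih =>
      intro ht
      by_cases htn : t < n
      · rw [Nat.mod_eq_of_lt htn]
      · obtain ⟨t, rfl⟩ := Nat.exists_eq_add_of_le' (not_lt.1 htn)
        rw [Nat.add_mod_right, ← ih t (by omega) (by omega), ← add_assoc]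
        refine h.apply_add_eq ?_ ?_
        · rw [add_assoc]; exact hrun _ (by omega) (by omega)
        · rw [add_assoc, add_assoc]; exact hrun _ (by omega) (by omega)
  -- A longer power would give `N + 1` consecutive windows on the cycle.
  have hind := mul_ind_eq (segment_mem_language u (k + 1) (N + n - 1)) hpow (by
    rintro v ⟨i, hi⟩ hv
    generalize hM : v.length = M at hi
    subst hi
    simp only [length_segment] at hM ⊢
    by_contra! hlt
    have hv := (isPower_segment hpos (by omega)).1 hv
    obtain ⟨c, hc⟩ := hrun 1 one_pos (by omega)
    have := hmax i (N + 1) fun t ht => ⟨c + t, fun b hb => by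
      rw [add_assoc, hv _ (by omega), hc _ (Nat.mod_lt _ hpos)]
      congr 1
      rw [ZMod.natCast_mod]
      push_cast
      ring⟩
    omega)
  refine ⟨_, segment_mem_language u (k + 1) n, length_segment .., ?_⟩
  rw [hind, length_segment, length_segment]
  have hR : recurrenceFunction u n = N + n := by
    refine IsLeast.csInf_eq ⟨?_, ?_⟩
    · intro j w hw
      rw [factors_eq_range] at hw
      obtain ⟨i, rfl⟩ := hw
      obtain ⟨t, ht, hag⟩ := h.exists_agree_of_longest_run hu hrec haper hk hrun hkN hmax i j
      exact occursInWindow_segment.2 ⟨j + t, by omega, by omega, hag⟩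
    -- The run has only `N + n - 1` letters and misses the factor at `k`.
    · intro L hL
      obtain ⟨j, hj, hjL, hag⟩ :=
        occursInWindow_segment.1 (hL (k + 1) _ (segment_mem_factors u k n))
      by_contra! hlt
      obtain ⟨t, rfl⟩ := Nat.exists_eq_add_of_le hj
      refine hk (OnCycle.of_agree (i := k + 1 + t) ?_ hag)
      rw [add_assoc]
      exact hrun _ (by omega) (by omega)
  rw [hR, show N + n = N + n - 1 + 1 by omega]
  push_cast
  rfl

end IsShortestReturn

end InfiniteWord

/-! ### The characterization -/

theorem theoremt {A : Type*} [Finite A] (u : ℕ → A)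
    (hrec : InfiniteWord.IsUniformlyRecurrent u) (haper : InfiniteWord.IsAperiodic u) :
    InfiniteWord.IsSturmian u ↔
      {w : List A | w ≠ [] ∧ w ∈ InfiniteWord.language u ∧
        (InfiniteWord.recurrenceFunction u w.length : ℝ≥0∞) =
          (w.length : ℝ≥0∞) * InfiniteWord.ind u w + 1}.Infinite := by
  constructor
  · intro hu hfin
    obtain ⟨B, hB⟩ := (hfin.image List.length).bddAbove
    obtain ⟨K, n, s, hn, h⟩ := hu.exists_isShortestReturn hrec haper (B + 1)
    obtain ⟨w, hw, rfl, hR⟩ := h.exists_recurrenceFunction_eq hu hrec haper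
    have hne : w ≠ [] := List.length_pos_iff.1 (by omega)
    have := hB ⟨w, ⟨hne, hw, hR⟩, rfl⟩
    omega
  · intro hinf
    refine haper.isSturmian_of_frequently fun N => ?_
    obtain ⟨w, ⟨hne, hw, hR⟩, hN⟩ := hinf.exists_notMem_finite (List.finite_length_lt A N)
    obtain ⟨v, hv, hp, hR⟩ := InfiniteWord.exists_isPower_of_mul_ind_add_one_eq hne hw hR
    exact ⟨w.length, not_lt.1 hN,
      InfiniteWord.complexity_le_of_recurrenceFunction_eq hv hp hR⟩
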